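/- \textbf{Theorem.} There is a universal constant $C\ge 0$ such that for every $n\in\{1,2,\dots\}$, every $\mathcal D\subseteq\{0,1\}^n$ and every (possibly partial) Boolean function $f:\mathcal D\to\{0,1\}$, \[\mathsf{st}(f)\;\le\; C\cdot \mathsf R(f),\] i.e. $\mathsf{st}(f)\in O(\mathsf R(f))$. Here the two complexity measures are defined as follows. \emph{Effective resistance.} Let $G=(V,E)$ be a finite undirected multigraph, where every edge is given an arbitrary default direction, let $s\ne t$ be vertices, and let $r:E\to[0,\infty]$. A unit $st$-flow is a function $\varphi:E\to\mathbb C$ with $\varphi_e=0$ whenever $r_e=\infty$, whose net outflow (sum over outgoing edges minus sum over incoming edges) is $1$ at $s$, $-1$ at $t$ and $0$ at every other vertex. The effective resistance $R_{G,s,t,r}$ is the minimum of $\sum_{e\in E}|\varphi_e|^2 r_e$ over all unit $st$-flows $\varphi$ (with $0\cdot\infty=0$), and $\infty$ if there is no unit $st$-flow. \emph{$st$-connectivity complexity.} An $st$-connectivity graph $\mathcal G$ consists of a finite undirected multigraph $G=(V,E)$ with resistances $r:E\to\mathbb R_{>0}$, vertices $s\neq t$, and for every $e\in E$ an index $j(e)\in\{1,\dots,n\}$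 and a bit $b(e)\in\{0,1\}$. For $x\in\{0,1\}^n$ put $E(x)=\{e\in E: x_{j(e)}=b(e)\}$ and $G(x)=(V,E(x))$. We say that $\mathcal G$ computes $f$ if for all $x\in\mathcal D$: $f(x)=1$ if and only if $s$ and $t$ are connected by a path in $G(x)$. Let $w_+(x,\mathcal G)=R_{G(x),s,t,r}$ and $w_-(x,\mathcal G)=R_{G,s,t,r'}^{-1}$, where $r'_e=r_e$ if $x_{j(e)}\ne b(e)$ and $r'_e=0$ otherwise. The complexity of a graph $\mathcal G$ computing $f$ is \[C(\mathcal G)=\sqrt{\max_{x\in f^{-1}(1)}w_+(x,\mathcal G)\cdot\max_{x\in f^{-1}(0)}w_-(x,\mathcal G)},\] where a maximum over the empty set is $0$, and $\mathsf{st}(f)$ is the minimal complexity, i.e. the infimum of $C(\mathcal G)$ over all $st$-connectivity graphs $\mathcal G$ that compute $f$. \emph{Randomized query complexity.} A randomized query algorithm is a probability distribution $(p_i)_{i=1}^k$ on a finite family $(T_i)_{i=1}^k$ of deterministic decision trees querying single bits of $x\in\{0,1\}^n$. It computes $f$ if for all $x\in\mathcal D$ the probability that $T_i(x)=f(x)$,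 for $i$ drawn according to $p$, is at least $2/3$. $\mathsf R(f)$ is the least $T\in\{0,1,2,\dots\}$ such that some randomized query algorithm whose trees all have depth at most $T$ computes $f$. -/

import Mathlib

open scoped ENNReal NNReal

/-! ### Electrical networks -/

section Network

variable {V E : Type} [Fintype E] [DecidableEq V]

/-- `f` is a unit `st`-flow on the undirected multigraph whose edge `e` has the default direction
from `tail e` to `head e`, with resistances `r e ∈ [0, ∞]`: it vanishes on the edges of infinite
resistance, and its net outflow is `1` at `s`, `-1` at `t`, and `0` elsewhere. -/
def IsUnitFlow (tail head : E → V) (s t : V) (r : E → ℝ≥0∞) (f : E → ℂ) : Prop :=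
  (∀ e, r e = ∞ → f e = 0) ∧
  ∀ v, (∑ e with tail e = v, f e) - (∑ e with head e = v, f e) =
    if v = s then 1 else if v = t then -1 else 0

/-- The energy `∑ |f e|² r e` of a flow, with the convention `0 * ∞ = 0`. -/
noncomputable def flowEnergy (r : E → ℝ≥0∞) (f : E → ℂ) : ℝ≥0∞ :=
  ∑ e, ‖f e‖ₑ ^ 2 * r e

/-- The effective resistance between `s` and `t`: the minimum energy of a unit `st`-flow, and `∞`
if there is no unit `st`-flow. -/
noncomputable def effectiveResistance (tail head : E → V) (s t : V) (r : E → ℝ≥0∞) : ℝ≥0∞ :=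
  ⨅ (f : E → ℂ) (_ : IsUnitFlow tail head s t r f), flowEnergy r f

end Network

/-! ### `st`-connectivity graphs -/

/-- An `st`-connectivity graph for `n`-bit inputs: a finite undirected multigraph with positive
finite resistances, two distinct vertices `s` and `t`, and for each edge `e` a bit position `j e`
together with the value `b e` of that bit for which `e` is available. The default direction of an
edge (from `tail e` to `head e`) serves only as the sign convention for flows. -/
structure STGraph (n : ℕ) where
  V : Type
  E : Type
  [fintypeV : Fintype V]
  [decEqV : DecidableEq V]
  [fintypeE : Fintype E]
  tail : E → V
  head : E → V
  s : V
  t : V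
  s_ne_t : s ≠ t
  j : E → Fin n
  b : E → Bool
  r : E → ℝ
  r_pos : ∀ e, 0 < r e

namespace STGraph

attribute [instance] fintypeV decEqV fintypeE

variable {n : ℕ}

/-- The edge `e` is available on input `x`, i.e. it belongs to the edge set `E(x)`. -/
def Avail (G : STGraph n) (x : Fin n → Bool) (e : G.E) : Prop :=
  x (G.j e) = G.b e

instance (G : STGraph n) (x : Fin n → Bool) : DecidablePred (G.Avail x) :=
  fun e => inferInstanceAs (Decidable (x (G.j e) = G.b e))

/-- `u` and `v` are the two endpoints of an edge that is available on input `x`. -/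
def Adj (G : STGraph n) (x : Fin n → Bool) (u v : G.V) : Prop :=
  ∃ e, G.Avail x e ∧ ((G.tail e = u ∧ G.head e = v) ∨ (G.tail e = v ∧ G.head e = u))

/-- There is a path from `s` to `t` in the subgraph `G(x)` of available edges. -/
def Connected (G : STGraph n) (x : Fin n → Bool) : Prop :=
  Relation.ReflTransGen (G.Adj x) G.s G.t

/-- `G` computes `f`: for all `x` in the domain, `f x = 1` iff `s` and `t` are connected in
`G(x)`. -/
def Computes (G : STGraph n) {D : Set (Fin n → Bool)} (f : D → Bool) : Prop :=
  ∀ x : D, f x = true ↔ G.Connected x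

/-- The positive witness size: the effective resistance between `s` and `t` in `G(x)`. Removing an
edge amounts to giving it infinite resistance. -/
noncomputable def posWitness (G : STGraph n) (x : Fin n → Bool) : ℝ≥0∞ :=
  effectiveResistance G.tail G.head G.s G.t
    (fun e => if G.Avail x e then ENNReal.ofReal (G.r e) else ∞)

/-- The negative witness size: the inverse of the effective resistance between `s` and `t` in the
network obtained from `G` by giving resistance `0` to the available edges, while the unavailable
edges keep their resistance. -/
noncomputable def negWitness (G : STGraph n) (x : Fin n → Bool) : ℝ≥0∞ :=
  (effectiveResistance G.tail G.head G.s G.t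
    (fun e => if G.Avail x e then 0 else ENNReal.ofReal (G.r e)))⁻¹

/-- The complexity of `G` as an `st`-connectivity graph computing `f`; a maximum over the empty set
is `0`. -/
noncomputable def complexity (G : STGraph n) {D : Set (Fin n → Bool)} (f : D → Bool) : ℝ≥0∞ :=
  ((⨆ (x : D) (_ : f x = true), G.posWitness x) *
    (⨆ (x : D) (_ : f x = false), G.negWitness x)) ^ (1 / 2 : ℝ)

end STGraph

/-- The `st`-connectivity complexity `st(f)`: the least complexity of an `st`-connectivity graph
that computes `f` (`∞` if there is none). -/
noncomputable def stComplexity {n : ℕ} {D : Set (Fin n → Bool)} (f : D → Bool) : ℝ≥0∞ :=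
  ⨅ (G : STGraph n) (_ : G.Computes f), G.complexity f

/-! ### Randomized query complexity -/

/-- Deterministic decision trees on `n`-bit inputs; `query i t₀ t₁` queries bit `i` and continues
with `t₀` on outcome `0` and with `t₁` on outcome `1`. -/
inductive DecisionTree (n : ℕ) : Type
  | leaf (output : Bool) : DecisionTree n
  | query (i : Fin n) (t₀ t₁ : DecisionTree n) : DecisionTree n

namespace DecisionTree

variable {n : ℕ}

/-- The output of the tree on input `x`. -/
def eval (x : Fin n → Bool) : DecisionTree n → Bool
  | leaf c => c
  | query i t₀ t₁ => if x i = true then t₁.eval x else t₀.eval x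

/-- The worst-case number of queries made by the tree. -/
def depth : DecisionTree n → ℕ
  | leaf _ => 0
  | query _ t₀ t₁ => max t₀.depth t₁.depth + 1

end DecisionTree

/-- A randomized query algorithm: a probability distribution on a finite family of deterministic
decision trees. -/
structure RandomizedAlgorithm (n : ℕ) where
  k : ℕ
  tree : Fin k → DecisionTree n
  prob : Fin k → ℝ
  prob_nonneg : ∀ i, 0 ≤ prob i
  prob_sum : ∑ i, prob i = 1

namespace RandomizedAlgorithm

variable {n : ℕ}

/-- `A` computes `f` with bounded error: on every `x` in the domain it outputs `f x` with
probability at least `2/3`. -/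
def Computes (A : RandomizedAlgorithm n) {D : Set (Fin n → Bool)} (f : D → Bool) : Prop :=
  ∀ x : D, (2 / 3 : ℝ) ≤ ∑ i with (A.tree i).eval x = f x, A.prob i

/-- `A` never makes more than `T` queries. -/
def QueriesAtMost (A : RandomizedAlgorithm n) (T : ℕ) : Prop :=
  ∀ i, (A.tree i).depth ≤ T

end RandomizedAlgorithm

/-- The bounded-error randomized query complexity `R(f)`: the least number of queries with which a
randomized algorithm computes `f` with error at most `1/3`. -/
noncomputable def randomizedQueryComplexity {n : ℕ} {D : Set (Fin n → Bool)} (f : D → Bool) : ℕ :=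
  sInf {T | ∃ A : RandomizedAlgorithm n, A.Computes f ∧ A.QueriesAtMost T}

/-! Let `A` be an algorithm of depth at most `T` that computes `f`. The tree of a deterministic
algorithm becomes a network when each query is an edge per outcome: the accepting path carries the
flow, and the edges leaving the computation path form a cut. A random tree errs, however, and one
error on a negative input connects `s` to `t`; majority amplification would cost a logarithmic
factor.

A branching process removes the errors instead. Every particle has two potential children, each
surviving if an independent run of `A` accepts. For fixed `x` with acceptance probability `p`, the
number `W` of particles in generation `L` has mean `(2p)^L`. On negative inputs `2p ≤ 2/3`, so for
large `L` the union bound makes it unlikely that any of them has survivors. On positive inputs `2p ≥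
4/3`: the second moment of `W` is at most twice the squared mean, and the flow sending one unit to
each survivor has mean energy at most `6T` times that square. Cuts on negative inputs have mean
energy at most `6T`. The geometric growth or decay per generation keeps all these bounds independent
of `L`.

Outcomes in which some negative input survives are discarded; by the second moment bound at least
half of the mean of `W` remains on each positive input. The remaining outcomes are placed in
parallel, with their probabilities as conductances. The normalised flow has energy at most `6T /
(1/2)^2 = 24T`, and the cuts add up to at most `6T`. See `branching_mean_W_sq_le`,
`branching_mean_U_le`, `branching_mean_N_le`, `half_mean_le_mean_ite` and
`stComplexity_le_of_computes`. -/

/-! ### Flows, potentials and effective resistance -/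

section Network

variable {V E : Type} [Fintype E] [DecidableEq V]

/-- Summation by parts for the divergence of `f` against a potential. -/
theorem sum_potential_mul_divergence [Fintype V] (tail head : E → V) (f : E → ℂ) (φ : V → ℂ) :
    ∑ v, φ v * ((∑ e with tail e = v, f e) - ∑ e with head e = v, f e) =
      ∑ e, f e * (φ (tail e) - φ (head e)) := by
  have key (g : E → V) : ∑ v, φ v * ∑ e with g e = v, f e = ∑ e, f e * φ (g e) := by
    simp_rw [Finset.mul_sum, Finset.sum_filter]
    rw [Finset.sum_comm]
    refine Finset.sum_congr rfl fun e _ => ?_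
    simp [mul_comm]
  simp_rw [mul_sub, Finset.sum_sub_distrib, key]

theorem IsUnitFlow.sum_mul_sub [Fintype V] {tail head : E → V} {s t : V} (hst : s ≠ t) {r : E → ℝ≥0∞}
    {f : E → ℂ} (hf : IsUnitFlow tail head s t r f) (φ : V → ℂ) :
    ∑ e, f e * (φ (tail e) - φ (head e)) = φ s - φ t := by
  rw [← sum_potential_mul_divergence]
  simp_rw [hf.2]
  have : ∀ v, φ v * (if v = s then (1 : ℂ) else if v = t then -1 else 0) =
      (if v = s then φ v else 0) - (if v = t then φ v else 0) := by
    intro v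
    by_cases h1 : v = s
    · subst h1; simp [hst]
    · by_cases h2 : v = t
      · subst h2; simp [h1]
      · simp [h1, h2]
  simp_rw [this, Finset.sum_sub_distrib]
  simp

/-- Pairing with the indicator of a vertex recovers the net outflow there. This weak form of
Kirchhoff's law behaves additively when networks are glued, so the flows below are built in it. -/
theorem isUnitFlow_of_sum_mul_sub {tail head : E → V} {s t : V} (hst : s ≠ t) {r : E → ℝ≥0∞}
    {g : E → ℝ} (hr : ∀ e, r e = ∞ → g e = 0)
    (hg : ∀ φ : V → ℝ, ∑ e, g e * (φ (tail e) - φ (head e)) = φ s - φ t) :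
    IsUnitFlow tail head s t r (fun e => (g e : ℂ)) := by
  refine ⟨fun e he => by simp [hr e he], fun v => ?_⟩
  have h := hg (fun u => if u = v then 1 else 0)
  simp only [mul_sub, mul_ite, mul_one, mul_zero, Finset.sum_sub_distrib, ← Finset.sum_filter] at h
  rw [← Complex.ofReal_sum, ← Complex.ofReal_sum, ← Complex.ofReal_sub, h]
  by_cases h1 : v = s
  · subst h1; simp [hst.symm]
  · by_cases h2 : v = t
    · subst h2; simp [hst, h1]
    · simp [h1, h2, Ne.symm h1, Ne.symm h2]

theorem flowEnergy_ofReal (r : E → ℝ) (hr : ∀ e, 0 ≤ r e) (f : E → ℂ) :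
    flowEnergy (fun e => ENNReal.ofReal (r e)) f = ENNReal.ofReal (∑ e, ‖f e‖ ^ 2 * r e) := by
  rw [flowEnergy, ENNReal.ofReal_sum_of_nonneg fun e _ => mul_nonneg (sq_nonneg _) (hr e)]
  refine Finset.sum_congr rfl fun e _ => ?_
  rw [ENNReal.ofReal_mul (sq_nonneg _), ENNReal.ofReal_pow (norm_nonneg _), ofReal_norm]

/-- A potential difference of `1` bounds the effective resistance from below. -/
theorem inv_le_effectiveResistance [Fintype V] {tail head : E → V} {s t : V} (hst : s ≠ t) (r : E → ℝ)
    (hr : ∀ e, 0 < r e) (avail : E → Prop) [DecidablePred avail] (φ : V → ℝ)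
    (hφ : φ s - φ t = 1) (ha : ∀ e, avail e → φ (tail e) = φ (head e)) {A : ℝ}
    (hA : 0 < A) (hs : ∑ e, (φ (tail e) - φ (head e)) ^ 2 / r e ≤ A) :
    (ENNReal.ofReal A)⁻¹ ≤ effectiveResistance tail head s t
      (fun e => if avail e then 0 else ENNReal.ofReal (r e)) := by
  refine le_iInf₂ fun f hf => ?_
  have hfun : (fun e => if avail e then 0 else ENNReal.ofReal (r e)) =
      fun e => ENNReal.ofReal (if avail e then 0 else r e) := by
    funext e; split_ifs <;> simp
  have h0 : ∀ e, 0 ≤ (if avail e then 0 else r e) := fun e => by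
    split_ifs
    · exact le_rfl
    · exact (hr e).le
  rw [hfun, flowEnergy_ofReal _ h0, ← ENNReal.ofReal_inv_of_pos hA]
  refine ENNReal.ofReal_le_ofReal ?_
  set S := ∑ e, ‖f e‖ ^ 2 * (if avail e then 0 else r e) with hS
  have h1 := hf.sum_mul_sub hst (fun v => (φ v : ℂ))
  rw [← Complex.ofReal_sub, hφ] at h1
  have h2 : (1 : ℝ) ≤ ∑ e, ‖f e‖ * |φ (tail e) - φ (head e)| := by
    have : ‖∑ e, f e * ((φ (tail e) : ℂ) - φ (head e))‖ = 1 := by rw [h1]; simp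
    rw [← this]
    refine (norm_sum_le _ _).trans (Finset.sum_le_sum fun e _ => ?_)
    rw [norm_mul, ← Complex.ofReal_sub, Complex.norm_real, Real.norm_eq_abs]
  -- Cauchy–Schwarz with weights `r e`. Available edges, of resistance `0`, contribute nothing
  -- because the potential is constant along them.
  have h3 : (∑ e, ‖f e‖ * |φ (tail e) - φ (head e)|) ^ 2 ≤
      S * ∑ e, (φ (tail e) - φ (head e)) ^ 2 / r e := by
    refine Finset.sum_sq_le_sum_mul_sum_of_sq_le_mul _
      (fun e _ => mul_nonneg (sq_nonneg _) (h0 e))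
      (fun e _ => div_nonneg (sq_nonneg _) (hr e).le) fun e _ => ?_
    by_cases h : avail e
    · simp [h, ha e h]
    · simp only [h, if_false, mul_pow, sq_abs]
      have := (hr e).ne'
      exact le_of_eq (by field_simp)
  have hS0 : 0 ≤ S := Finset.sum_nonneg fun e _ => mul_nonneg (sq_nonneg _) (h0 e)
  have h4 : 1 ≤ S * A := by
    calc (1 : ℝ) ≤ (∑ e, ‖f e‖ * |φ (tail e) - φ (head e)|) ^ 2 := one_le_pow₀ h2
      _ ≤ _ := h3
      _ ≤ S * A := mul_le_mul_of_nonneg_left hs hS0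
  rw [inv_le_iff_one_le_mul₀ hA]
  exact h4

end Network

/-! ### Certificates for the `st`-connectivity complexity -/

namespace STGraph

variable {n : ℕ}

theorem posWitness_le (G : STGraph n) (x : Fin n → Bool) (g : G.E → ℝ) {A : ℝ}
    (h0 : ∀ e, ¬ G.Avail x e → g e = 0)
    (hg : ∀ φ : G.V → ℝ, ∑ e, g e * (φ (G.tail e) - φ (G.head e)) = φ G.s - φ G.t)
    (hA : ∑ e, g e ^ 2 * G.r e ≤ A) : G.posWitness x ≤ ENNReal.ofReal A := by
  have hflow : IsUnitFlow G.tail G.head G.s G.t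
      (fun e => if G.Avail x e then ENNReal.ofReal (G.r e) else ∞) (fun e => (g e : ℂ)) := by
    refine isUnitFlow_of_sum_mul_sub G.s_ne_t (fun e he => h0 e fun h => ?_) hg
    simp [h] at he
  refine (iInf₂_le _ hflow).trans ?_
  refine le_trans (le_of_eq ?_) (ENNReal.ofReal_le_ofReal hA)
  calc _ = flowEnergy (fun e => ENNReal.ofReal (G.r e)) (fun e => (g e : ℂ)) := by
        refine Finset.sum_congr rfl fun e _ => ?_
        by_cases h : G.Avail x e <;> simp [h, h0]
    _ = _ := by
        rw [flowEnergy_ofReal _ fun e => (G.r_pos e).le]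
        simp

theorem negWitness_le (G : STGraph n) (x : Fin n → Bool) (φ : G.V → ℝ) {A : ℝ}
    (hA : 0 < A) (hφ : φ G.s - φ G.t = 1)
    (ha : ∀ e, G.Avail x e → φ (G.tail e) = φ (G.head e))
    (hs : ∑ e, (φ (G.tail e) - φ (G.head e)) ^ 2 / G.r e ≤ A) :
    G.negWitness x ≤ ENNReal.ofReal A := by
  rw [negWitness, ENNReal.inv_le_iff_inv_le]
  exact inv_le_effectiveResistance G.s_ne_t G.r G.r_pos (G.Avail x) φ hφ ha hA hs

theorem not_connected_of_potential (G : STGraph n) (x : Fin n → Bool) (φ : G.V → ℝ)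
    (hφ : φ G.s ≠ φ G.t) (ha : ∀ e, G.Avail x e → φ (G.tail e) = φ (G.head e)) :
    ¬ G.Connected x := by
  intro hc
  suffices h : ∀ v, Relation.ReflTransGen (G.Adj x) G.s v → φ G.s = φ v from hφ (h _ hc)
  intro v hv
  induction hv with
  | refl => rfl
  | tail _ h ih =>
    obtain ⟨e, he, ⟨h1, h2⟩ | ⟨h1, h2⟩⟩ := h
    · rw [ih, ← h1, ← h2, ha e he]
    · rw [ih, ← h1, ← h2, ha e he]

theorem connected_of_flow (G : STGraph n) (x : Fin n → Bool) (g : G.E → ℝ)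
    (h0 : ∀ e, ¬ G.Avail x e → g e = 0)
    (hg : ∀ φ : G.V → ℝ, ∑ e, g e * (φ (G.tail e) - φ (G.head e)) = φ G.s - φ G.t) :
    G.Connected x := by
  classical
  by_contra hc
  -- Against the indicator of the component of `s`, every edge term vanishes while the right-hand
  -- side is `1`.
  have h := hg fun v => if Relation.ReflTransGen (G.Adj x) G.s v then 1 else 0
  have hc' : ¬ Relation.ReflTransGen (G.Adj x) G.s G.t := hc
  rw [if_pos Relation.ReflTransGen.refl, if_neg hc', Finset.sum_eq_zero] at h
  · simp at h
  · intro e _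
    by_cases he : G.Avail x e
    · have : Relation.ReflTransGen (G.Adj x) G.s (G.tail e) ↔
          Relation.ReflTransGen (G.Adj x) G.s (G.head e) :=
        ⟨fun h => h.tail ⟨e, he, Or.inl ⟨rfl, rfl⟩⟩, fun h => h.tail ⟨e, he, Or.inr ⟨rfl, rfl⟩⟩⟩
      simp [this]
    · simp [h0 e he]

/-- Flows on the positive inputs and potentials on the negative inputs certify a bound on the
`st`-connectivity complexity. -/
theorem stComplexity_le (G : STGraph n) {D : Set (Fin n → Bool)} (f : D → Bool) {A : ℝ}
    (hA : 0 < A)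
    (hpos : ∀ x : D, f x = true → ∃ g : G.E → ℝ, (∀ e, ¬ G.Avail x e → g e = 0) ∧
      (∀ φ : G.V → ℝ, ∑ e, g e * (φ (G.tail e) - φ (G.head e)) = φ G.s - φ G.t) ∧
      ∑ e, g e ^ 2 * G.r e ≤ A)
    (hneg : ∀ x : D, f x = false → ∃ φ : G.V → ℝ, φ G.s - φ G.t = 1 ∧
      (∀ e, G.Avail x e → φ (G.tail e) = φ (G.head e)) ∧
      ∑ e, (φ (G.tail e) - φ (G.head e)) ^ 2 / G.r e ≤ A) :
    stComplexity f ≤ ENNReal.ofReal A := by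
  have hcomp : G.Computes f := by
    intro x
    refine ⟨fun h => ?_, fun h => ?_⟩
    · obtain ⟨g, h0, hg, -⟩ := hpos x h
      exact G.connected_of_flow x g h0 hg
    · by_contra hf
      obtain ⟨φ, hφ, ha, -⟩ := hneg x (by simpa using hf)
      exact G.not_connected_of_potential x φ (fun h => by rw [h, sub_self] at hφ; simp at hφ) ha h
  refine (iInf₂_le G hcomp).trans ?_
  have h1 : (⨆ (x : D) (_ : f x = true), G.posWitness x) ≤ ENNReal.ofReal A :=
    iSup₂_le fun x hx => by
      obtain ⟨g, h0, hg, hs⟩ := hpos x hx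
      exact G.posWitness_le x g h0 hg hs
  have h2 : (⨆ (x : D) (_ : f x = false), G.negWitness x) ≤ ENNReal.ofReal A :=
    iSup₂_le fun x hx => by
      obtain ⟨φ, hφ, ha, hs⟩ := hneg x hx
      exact G.negWitness_le x φ hA hφ ha hs
  calc G.complexity f ≤ (ENNReal.ofReal A * ENNReal.ofReal A) ^ (1 / 2 : ℝ) :=
        ENNReal.rpow_le_rpow (mul_le_mul' h1 h2) (by norm_num)
    _ = ENNReal.ofReal A := by
        rw [← pow_two, ← ENNReal.rpow_natCast, ← ENNReal.rpow_mul]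
        norm_num

/-- Constant functions have `st`-connectivity complexity `0`. -/
theorem stComplexity_eq_zero_of_const (hn : 1 ≤ n) {D : Set (Fin n → Bool)} (f : D → Bool)
    (c : Bool) (hf : ∀ x, f x = c) : stComplexity f = 0 := by
  let G : STGraph n :=
    { V := Bool, E := if c then Bool else Empty
      fintypeE := by cases c <;> simp <;> infer_instance
      tail := fun _ => false, head := fun _ => true, s := false, t := true, s_ne_t := by simp
      j := fun _ => ⟨0, hn⟩
      -- For `c = true` the two edges carry the two values of bit `0`, so one of them is always
      -- available.
      b := match c with
        | true => fun e => e
        | false => fun e => e.elim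
      r := fun _ => 1, r_pos := fun _ => one_pos }
  have hcomp : G.Computes f := by
    intro x
    cases c with
    | false =>
      refine iff_of_false (by simp [hf]) ?_
      refine G.not_connected_of_potential x (fun v : Bool => if v then 1 else 0) ?_
        (fun e => Empty.elim e)
      change (if false = true then (1 : ℝ) else 0) ≠ (if true = true then 1 else 0)
      simp
    | true =>
      refine iff_of_true (hf x) (Relation.ReflTransGen.single ⟨(x : Fin n → Bool) ⟨0, hn⟩, ?_, ?_⟩)
      · exact rfl
      · exact Or.inl ⟨rfl, rfl⟩
  refine le_antisymm ((iInf₂_le G hcomp).trans (le_of_eq ?_)) zero_le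
  unfold complexity
  -- One of the two maxima ranges over the empty set, and `0` times the other is `0` even if that is
  -- `∞`.
  cases c <;> simp [hf]

end STGraph

/-! ### Gadgets and their flows and cuts -/

/-- A rooted tree of labelled edges. The edge `e` hangs below the edge `par e`, or below the root if
`par e = none`; edges with `fin e` end in a common target vertex. -/
structure Gadget (n : ℕ) where
  E : Type
  [fintypeE : Fintype E]
  par : E → Option E
  fin : E → Bool
  j : E → Fin n
  b : E → Bool

namespace Gadget

attribute [instance] fintypeE

variable {n : ℕ}

/-- The value at the head of `e` of a potential with value `c` at the target. -/
def headVal (G : Gadget n) (φ : Option G.E → ℝ) (c : ℝ) (e : G.E) : ℝ :=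
  if G.fin e then c else φ (some e)

/-- There is a flow of strength `W` and energy at most `U` from the root to the target along the
edges available on input `x`. -/
def HasFlow (G : Gadget n) (x : Fin n → Bool) (W U : ℝ) : Prop :=
  ∃ g : G.E → ℝ, (∀ e, x (G.j e) ≠ G.b e → g e = 0) ∧
    (∀ φ c, ∑ e, g e * (φ (G.par e) - G.headVal φ c e) = W * (φ none - c)) ∧
    ∑ e, g e ^ 2 ≤ U

/-- There is a potential with value `1` at the root and `0` at the target, constant along the edges
available on input `x`, of energy at most `N`. -/
def HasCut (G : Gadget n) (x : Fin n → Bool) (N : ℝ) : Prop :=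
  ∃ φ : Option G.E → ℝ, φ none = 1 ∧
    (∀ e, x (G.j e) = G.b e → φ (G.par e) = G.headVal φ 0 e) ∧
    ∑ e, (φ (G.par e) - G.headVal φ 0 e) ^ 2 ≤ N

theorem HasFlow.mono {G : Gadget n} {x : Fin n → Bool} {W U U' : ℝ} (h : G.HasFlow x W U)
    (hU : U ≤ U') : G.HasFlow x W U' := by
  obtain ⟨g, h0, hg, hs⟩ := h
  exact ⟨g, h0, hg, hs.trans hU⟩

theorem HasCut.mono {G : Gadget n} {x : Fin n → Bool} {N N' : ℝ} (h : G.HasCut x N)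
    (hN : N ≤ N') : G.HasCut x N' := by
  obtain ⟨φ, h0, hg, hs⟩ := h
  exact ⟨φ, h0, hg, hs.trans hN⟩

theorem hasFlow_zero (G : Gadget n) (x : Fin n → Bool) : G.HasFlow x 0 0 :=
  ⟨0, by simp, by simp, by simp⟩

/-- The gadget without edges. -/
def empty : Gadget n where
  E := Empty
  par e := e.elim
  fin e := e.elim
  j e := e.elim
  b e := e.elim

theorem hasCut_empty (x : Fin n → Bool) : (empty : Gadget n).HasCut x 0 :=
  ⟨fun _ => 1, rfl, fun e => e.elim,
    (Finset.sum_eq_zero fun e _ => Empty.elim e).le⟩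

/-- The gadget whose root is joined to the target by two edges, one for each value of bit `i`. -/
def terminal (i : Fin n) : Gadget n where
  E := Bool
  par _ := none
  fin _ := true
  j _ := i
  b e := e

theorem hasFlow_terminal (i : Fin n) (x : Fin n → Bool) : (terminal i).HasFlow x 1 1 := by
  refine ⟨fun e : Bool => if x i = e then 1 else 0, fun e he => if_neg he, fun φ c => ?_, ?_⟩
  · change ∑ e : Bool, (if x i = e then (1 : ℝ) else 0) * (φ none - c) = _
    cases h : x i <;> simp
  · change ∑ e : Bool, (if x i = e then (1 : ℝ) else 0) ^ 2 ≤ 1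
    cases h : x i <;> simp

/-- Two gadgets with common root. -/
def fork (G H : Gadget n) : Gadget n where
  E := G.E ⊕ H.E
  par := Sum.elim (fun e => (G.par e).map Sum.inl) (fun e => (H.par e).map Sum.inr)
  fin := Sum.elim G.fin H.fin
  j := Sum.elim G.j H.j
  b := Sum.elim G.b H.b

theorem sum_fork {G H : Gadget n} (F : (fork G H).E → ℝ) :
    ∑ e, F e = ∑ e, F (Sum.inl e) + ∑ e, F (Sum.inr e) :=
  Fintype.sum_sum_type F

theorem HasFlow.fork {G H : Gadget n} {x : Fin n → Bool} {W U W' U' : ℝ}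
    (hG : G.HasFlow x W U) (hH : H.HasFlow x W' U') :
    (fork G H).HasFlow x (W + W') (U + U') := by
  obtain ⟨g, g0, gf, gs⟩ := hG
  obtain ⟨h, h0, hf, hs⟩ := hH
  refine ⟨Sum.elim g h, ?_, fun φ c => ?_, ?_⟩
  · rintro (e | e) he
    · exact g0 e he
    · exact h0 e he
  · rw [sum_fork, add_mul]
    congr 1
    · exact gf (fun o => φ (o.map Sum.inl)) c
    · exact hf (fun o => φ (o.map Sum.inr)) c
  · rw [sum_fork]
    exact add_le_add gs hs

theorem HasCut.fork {G H : Gadget n} {x : Fin n → Bool} {N N' : ℝ}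
    (hG : G.HasCut x N) (hH : H.HasCut x N') : (fork G H).HasCut x (N + N') := by
  obtain ⟨φ, φ0, φa, φs⟩ := hG
  obtain ⟨ψ, ψ0, ψa, ψs⟩ := hH
  let χ : Option (G.E ⊕ H.E) → ℝ := fun o =>
    o.elim 1 (Sum.elim (fun e => φ (some e)) (fun e => ψ (some e)))
  have hl : ∀ o : Option G.E, χ (o.map Sum.inl) = φ o := by rintro (_ | e) <;> simp [χ, φ0]
  have hr : ∀ o : Option H.E, χ (o.map Sum.inr) = ψ o := by rintro (_ | e) <;> simp [χ, ψ0]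
  have hl' : ∀ e, χ ((G.par e).map Sum.inl) - (Gadget.fork G H).headVal χ 0 (Sum.inl e) =
      φ (G.par e) - G.headVal φ 0 e := fun e => by rw [hl]; rfl
  have hr' : ∀ e, χ ((H.par e).map Sum.inr) - (Gadget.fork G H).headVal χ 0 (Sum.inr e) =
      ψ (H.par e) - H.headVal ψ 0 e := fun e => by rw [hr]; rfl
  refine ⟨χ, rfl, ?_, ?_⟩
  · rintro (e | e) he
    · exact sub_eq_zero.1 ((hl' e).trans (sub_eq_zero.2 (φa e he)))
    · exact sub_eq_zero.1 ((hr' e).trans (sub_eq_zero.2 (ψa e he)))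
  · rw [sum_fork]
    refine add_le_add (le_trans (le_of_eq ?_) φs) (le_trans (le_of_eq ?_) ψs)
    · exact Finset.sum_congr rfl fun e _ => congrArg (· ^ 2) (hl' e)
    · exact Finset.sum_congr rfl fun e _ => congrArg (· ^ 2) (hr' e)

/-- An edge labelled by bit `i` and value `c`, with a gadget at its end. -/
def edge (i : Fin n) (c : Bool) (G : Gadget n) : Gadget n where
  E := Option G.E
  par e := e.elim none (fun e => some (G.par e))
  fin e := e.elim false G.fin
  j e := e.elim i G.j
  b e := e.elim c G.b

theorem sum_edge {i : Fin n} {c : Bool} {G : Gadget n} (F : (edge i c G).E → ℝ) :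
    ∑ e, F e = F none + ∑ e, F (some e) :=
  Fintype.sum_option F

/-- The new edge carries the whole flow, hence the extra energy `W ^ 2`. -/
theorem HasFlow.edge {G : Gadget n} {x : Fin n → Bool} {W U : ℝ} (hG : G.HasFlow x W U)
    {i : Fin n} {c : Bool} (hi : x i = c) : (edge i c G).HasFlow x W (U + W ^ 2) := by
  obtain ⟨g, g0, gf, gs⟩ := hG
  refine ⟨fun e => Option.elim e W g, ?_, fun φ c => ?_, ?_⟩
  · rintro (_ | e) he
    · exact absurd hi he
    · exact g0 e he
  · rw [sum_edge]
    have h := gf (fun o => φ (some o)) c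
    refine (congrArg₂ (· + ·) (rfl : _ = W * (φ none - φ (some none))) h).trans ?_
    ring
  · rw [sum_edge, add_comm]
    exact add_le_add gs le_rfl

/-- Keeping the new root at potential `1` makes the new edge free, whether or not it is available.
-/
theorem HasCut.edge {G : Gadget n} {x : Fin n → Bool} {N : ℝ} (hG : G.HasCut x N)
    (i : Fin n) (c : Bool) : (edge i c G).HasCut x N := by
  obtain ⟨φ, φ0, φa, φs⟩ := hG
  refine ⟨fun o => Option.elim o 1 φ, rfl, ?_, ?_⟩
  · rintro (_ | e) he
    · exact φ0.symm
    · exact φa e he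
  · rw [sum_edge]
    refine (congrArg₂ (· + ·) (?_ : _ = (0 : ℝ))
      (rfl : _ = ∑ e, (φ (G.par e) - G.headVal φ 0 e) ^ 2)).trans_le ?_
    · change (1 - φ none) ^ 2 = 0
      simp [φ0]
    · simpa using φs

/-- The whole drop from `1` to `0` happens on the unavailable edge; everything below it has
potential `0`. -/
theorem hasCut_edge_of_ne (G : Gadget n) {x : Fin n → Bool} {i : Fin n} {c : Bool}
    (hi : x i ≠ c) : (edge i c G).HasCut x 1 := by
  refine ⟨fun o => Option.elim o 1 0, rfl, ?_, ?_⟩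
  · rintro (_ | e) he
    · exact absurd he hi
    · change (0 : ℝ) = if G.fin e = true then 0 else 0
      simp
  · rw [sum_edge]
    refine (congrArg₂ (· + ·) (?_ : _ = (1 : ℝ)) (Finset.sum_eq_zero fun e _ => ?_)).trans_le
      (add_zero (1 : ℝ)).le
    · change ((1 : ℝ) - 0) ^ 2 = 1
      norm_num
    · change ((0 : ℝ) - if G.fin e = true then 0 else 0) ^ 2 = 0
      simp

/-- The gadget of a decision tree, with `G` attached to the leaves with output `1`. -/
def ofTree (G : Gadget n) : DecisionTree n → Gadget n
  | .leaf c => if c then G else empty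
  | .query i t₀ t₁ => fork (edge i false (G.ofTree t₀)) (edge i true (G.ofTree t₁))

/-- The flow follows the computation path of `x`, which has at most `T.depth` edges, and then enters
the copy of `G` at its leaf. -/
theorem HasFlow.ofTree {G : Gadget n} {x : Fin n → Bool} {W U : ℝ} (hG : G.HasFlow x W U)
    (T : DecisionTree n) (hT : T.eval x = true) :
    (G.ofTree T).HasFlow x W (U + T.depth * W ^ 2) := by
  induction T with
  | leaf c =>
    have : c = true := hT
    subst this
    simpa [Gadget.ofTree, DecisionTree.depth] using hG
  | query i t₀ t₁ ih₀ ih₁ =>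
    have hW := sq_nonneg W
    cases hx : x i with
    | false =>
      have h := ((ih₀ (by simpa [DecisionTree.eval, hx] using hT)).edge hx).fork
        (hasFlow_zero (Gadget.edge i true (G.ofTree t₁)) x)
      rw [add_zero] at h
      refine h.mono ?_
      have : (t₀.depth : ℝ) ≤ (max t₀.depth t₁.depth : ℕ) := by exact_mod_cast le_max_left _ _
      simp only [DecisionTree.depth, Nat.cast_add, Nat.cast_one]
      nlinarith
    | true =>
      have h := (hasFlow_zero (Gadget.edge i false (G.ofTree t₀)) x).fork
        ((ih₁ (by simpa [DecisionTree.eval, hx] using hT)).edge hx)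
      rw [zero_add] at h
      refine h.mono ?_
      have : (t₁.depth : ℝ) ≤ (max t₀.depth t₁.depth : ℕ) := by exact_mod_cast le_max_right _ _
      simp only [DecisionTree.depth, Nat.cast_add, Nat.cast_one]
      nlinarith

/-- The computation path stays at potential `1`. Each query on it leaves one unavailable edge to cut
at cost `1`, and the copy of `G` at the leaf has to be cut only if the tree accepts. -/
theorem hasCut_ofTree {G : Gadget n} {x : Fin n → Bool} {N : ℝ}
    (T : DecisionTree n) (hG : T.eval x = true → G.HasCut x N) :
    (G.ofTree T).HasCut x ((if T.eval x = true then N else 0) + T.depth) := by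
  induction T with
  | leaf c =>
    cases c with
    | false => simpa [ofTree, DecisionTree.depth, DecisionTree.eval] using hasCut_empty x
    | true => simpa [ofTree, DecisionTree.depth, DecisionTree.eval] using hG rfl
  | query i t₀ t₁ ih₀ ih₁ =>
    cases hx : x i with
    | false =>
      have he : (DecisionTree.query i t₀ t₁).eval x = t₀.eval x := by
        simp [DecisionTree.eval, hx]
      rw [he] at hG ⊢
      have h := ((ih₀ hG).edge i false).fork
        (hasCut_edge_of_ne (G.ofTree t₁) (by simp [hx] : x i ≠ true))
      refine h.mono ?_
      have : (t₀.depth : ℝ) ≤ (max t₀.depth t₁.depth : ℕ) := by exact_mod_cast le_max_left _ _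
      simp only [DecisionTree.depth, Nat.cast_add, Nat.cast_one]
      linarith
    | true =>
      have he : (DecisionTree.query i t₀ t₁).eval x = t₁.eval x := by
        simp [DecisionTree.eval, hx]
      rw [he] at hG ⊢
      have h := (hasCut_edge_of_ne (G.ofTree t₀) (by simp [hx] : x i ≠ false)).fork
        ((ih₁ hG).edge i true)
      refine h.mono ?_
      have : (t₁.depth : ℝ) ≤ (max t₀.depth t₁.depth : ℕ) := by exact_mod_cast le_max_right _ _
      simp only [DecisionTree.depth, Nat.cast_add, Nat.cast_one]
      linarith

/-! ### Parallel composition of gadgets -/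

section Parallel

variable {ι : Type} [Fintype ι]

/-- The gadgets `G ω` in parallel, the edges of `G ω` having conductance `c ω`. -/
noncomputable def parallel (G : ι → Gadget n) (c : ι → ℝ) (hc : ∀ ω, 0 < c ω) : STGraph n where
  V := (Σ ω, (G ω).E) ⊕ Bool
  E := Σ ω, (G ω).E
  decEqV := Classical.decEq _
  tail e := ((G e.1).par e.2).elim (Sum.inr false) (fun e' => Sum.inl ⟨e.1, e'⟩)
  head e := if (G e.1).fin e.2 then Sum.inr true else Sum.inl e
  s := Sum.inr false
  t := Sum.inr true
  s_ne_t := by simp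
  j e := (G e.1).j e.2
  b e := (G e.1).b e.2
  r e := (c e.1)⁻¹
  r_pos e := inv_pos.2 (hc e.1)

variable {G : ι → Gadget n} {c : ι → ℝ} {hc : ∀ ω, 0 < c ω}

theorem sum_parallel (F : (parallel G c hc).E → ℝ) :
    ∑ e, F e = ∑ ω, ∑ e, F ⟨ω, e⟩ :=
  Fintype.sum_sigma F

/-- The restriction of a potential on `parallel G c hc` to the gadget `G ω`. -/
def restrict (G : ι → Gadget n) (φ : (Σ ω, (G ω).E) ⊕ Bool → ℝ) (ω : ι) (o : Option (G ω).E) : ℝ :=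
  o.elim (φ (Sum.inr false)) (fun e => φ (Sum.inl ⟨ω, e⟩))

theorem parallel_tail_sub_head (φ : (parallel G c hc).V → ℝ) (ω : ι) (e : (G ω).E) :
    φ ((parallel G c hc).tail ⟨ω, e⟩) - φ ((parallel G c hc).head ⟨ω, e⟩) =
      restrict G φ ω ((G ω).par e) - (G ω).headVal (restrict G φ ω) (φ (Sum.inr true)) e := by
  congr 1
  · change φ (((G ω).par e).elim (Sum.inr false) (fun e' => Sum.inl ⟨ω, e'⟩)) = _
    cases (G ω).par e <;> rfl
  · change φ (if (G ω).fin e then Sum.inr true else Sum.inl ⟨ω, e⟩) = _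
    unfold headVal
    cases (G ω).fin e <;> rfl

theorem exists_flow_parallel {x : Fin n → Bool} {W U : ι → ℝ}
    (h : ∀ ω, (G ω).HasFlow x (W ω) (U ω)) (hW : 0 < ∑ ω, c ω * W ω) :
    ∃ g : (parallel G c hc).E → ℝ, (∀ e, ¬ (parallel G c hc).Avail x e → g e = 0) ∧
      (∀ φ : (parallel G c hc).V → ℝ,
        ∑ e, g e * (φ ((parallel G c hc).tail e) - φ ((parallel G c hc).head e)) =
          φ (parallel G c hc).s - φ (parallel G c hc).t) ∧
      ∑ e, g e ^ 2 * (parallel G c hc).r e ≤ (∑ ω, c ω * U ω) / (∑ ω, c ω * W ω) ^ 2 := by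
  choose g g0 gf gs using h
  set S := ∑ ω, c ω * W ω with hS
  -- Scaling the flow of `G ω` by `c ω / S` makes the total strength `1`. Since the resistances are
  -- `1 / c ω`, its energy becomes `c ω / S ^ 2` times the original sum of squares.
  refine ⟨fun e => S⁻¹ * (c e.1 * g e.1 e.2), fun e he => ?_, fun φ => ?_, ?_⟩
  · have := g0 e.1 e.2 he
    simp [this]
  · rw [sum_parallel]
    have : ∀ ω, ∑ e, S⁻¹ * (c ω * g ω e) * (φ ((parallel G c hc).tail ⟨ω, e⟩) -
        φ ((parallel G c hc).head ⟨ω, e⟩)) =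
          (c ω * W ω) * (S⁻¹ * (φ (Sum.inr false) - φ (Sum.inr true))) := by
      intro ω
      have h1 := gf ω (restrict G φ ω) (φ (Sum.inr true))
      simp_rw [parallel_tail_sub_head, mul_assoc, ← Finset.mul_sum, h1]
      change S⁻¹ * (c ω * (W ω * (φ (Sum.inr false) - _))) = _
      ring
    rw [Finset.sum_congr rfl fun ω _ => this ω, ← Finset.sum_mul, ← hS, ← mul_assoc,
      mul_inv_cancel₀ hW.ne', one_mul]
    rfl
  · rw [sum_parallel, Finset.sum_div]
    refine Finset.sum_le_sum fun ω _ => ?_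
    have : ∀ e, (S⁻¹ * (c ω * g ω e)) ^ 2 * (parallel G c hc).r ⟨ω, e⟩ =
        (c ω / S ^ 2) * g ω e ^ 2 := by
      intro e
      change _ * (c ω)⁻¹ = _
      have := (hc ω).ne'
      field_simp
    simp_rw [this, ← Finset.mul_sum]
    calc c ω / S ^ 2 * ∑ e, g ω e ^ 2 ≤ c ω / S ^ 2 * U ω :=
          mul_le_mul_of_nonneg_left (gs ω) (div_nonneg (hc ω).le (sq_nonneg _))
      _ = _ := by ring

theorem exists_potential_parallel {x : Fin n → Bool} {N : ι → ℝ}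
    (h : ∀ ω, (G ω).HasCut x (N ω)) :
    ∃ φ : (parallel G c hc).V → ℝ, φ (parallel G c hc).s - φ (parallel G c hc).t = 1 ∧
      (∀ e, (parallel G c hc).Avail x e →
        φ ((parallel G c hc).tail e) = φ ((parallel G c hc).head e)) ∧
      ∑ e, (φ ((parallel G c hc).tail e) - φ ((parallel G c hc).head e)) ^ 2 /
        (parallel G c hc).r e ≤ ∑ ω, c ω * N ω := by
  choose φ φ0 φa φs using h
  let ψ : (Σ ω, (G ω).E) ⊕ Bool → ℝ :=
    Sum.elim (fun e => φ e.1 (some e.2)) (fun b => if b then 0 else 1)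
  have hr : ∀ ω, restrict G ψ ω = φ ω := by
    intro ω
    funext o
    cases o with
    | none => simp [restrict, ψ, φ0]
    | some e => simp [restrict, ψ]
  have hψ : ψ (Sum.inr true) = 0 := by simp [ψ]
  have hd : ∀ ω e, ψ ((parallel G c hc).tail ⟨ω, e⟩) - ψ ((parallel G c hc).head ⟨ω, e⟩) =
      φ ω ((G ω).par e) - (G ω).headVal (φ ω) 0 e := fun ω e => by
    have := parallel_tail_sub_head (hc := hc) ψ ω e
    rwa [hr, hψ] at this
  refine ⟨ψ, ?_, ?_, ?_⟩
  · change (if false = true then (0 : ℝ) else 1) - (if true = true then 0 else 1) = 1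
    simp
  · rintro ⟨ω, e⟩ he
    exact sub_eq_zero.1 ((hd ω e).trans (sub_eq_zero.2 (φa ω e he)))
  · rw [sum_parallel]
    refine Finset.sum_le_sum fun ω _ => ?_
    simp_rw [hd]
    change ∑ e, _ / (c ω)⁻¹ ≤ _
    simp_rw [div_inv_eq_mul, ← Finset.sum_mul]
    rw [mul_comm]
    exact mul_le_mul_of_nonneg_left (φs ω) (hc ω).le

end Parallel

end Gadget

/-! ### Random gadgets and their means -/

/-- A finite probability distribution on gadgets, with, for each input, the strength `W` and an
energy bound `U` of a flow, and an energy bound `N` of a potential that exists if `W = 0`. -/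
structure Ensemble (n : ℕ) where
  Ω : Type
  [fintypeΩ : Fintype Ω]
  wt : Ω → ℝ
  gadget : Ω → Gadget n
  W : (Fin n → Bool) → Ω → ℝ
  U : (Fin n → Bool) → Ω → ℝ
  N : (Fin n → Bool) → Ω → ℝ
  wt_nonneg : ∀ ω, 0 ≤ wt ω
  wt_sum : ∑ ω, wt ω = 1
  W_eq_zero_or : ∀ x ω, W x ω = 0 ∨ 1 ≤ W x ω
  U_nonneg : ∀ x ω, 0 ≤ U x ω
  N_nonneg : ∀ x ω, 0 ≤ N x ω
  hasFlow : ∀ x ω, (gadget ω).HasFlow x (W x ω) (U x ω)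
  hasCut : ∀ x ω, W x ω = 0 → (gadget ω).HasCut x (N x ω)

namespace Ensemble

attribute [instance] fintypeΩ

variable {n : ℕ}

theorem W_nonneg (S : Ensemble n) (x : Fin n → Bool) (ω : S.Ω) : 0 ≤ S.W x ω := by
  rcases S.W_eq_zero_or x ω with h | h
  · exact h.ge
  · exact zero_le_one.trans h

/-- The expectation of `F`. -/
noncomputable def mean (S : Ensemble n) (F : S.Ω → ℝ) : ℝ := ∑ ω, S.wt ω * F ω

theorem mean_mono (S : Ensemble n) {F F' : S.Ω → ℝ} (h : ∀ ω, F ω ≤ F' ω) : S.mean F ≤ S.mean F' :=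
  Finset.sum_le_sum fun ω _ => mul_le_mul_of_nonneg_left (h ω) (S.wt_nonneg ω)

theorem mean_nonneg (S : Ensemble n) {F : S.Ω → ℝ} (h : ∀ ω, 0 ≤ F ω) : 0 ≤ S.mean F :=
  Finset.sum_nonneg fun ω _ => mul_nonneg (S.wt_nonneg ω) (h ω)

theorem mean_add (S : Ensemble n) (F F' : S.Ω → ℝ) :
    S.mean (fun ω => F ω + F' ω) = S.mean F + S.mean F' := by
  simp only [mean, mul_add, Finset.sum_add_distrib]

theorem mean_const_mul (S : Ensemble n) (c : ℝ) (F : S.Ω → ℝ) :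
    S.mean (fun ω => c * F ω) = c * S.mean F := by
  simp only [mean, Finset.mul_sum]
  exact Finset.sum_congr rfl fun ω _ => by ring

theorem mean_const (S : Ensemble n) (c : ℝ) : S.mean (fun _ => c) = c := by
  simp only [mean, ← Finset.sum_mul, S.wt_sum, one_mul]

/-- The deterministic ensemble of a terminal gadget. -/
def terminal (i : Fin n) : Ensemble n where
  Ω := Unit
  wt _ := 1
  gadget _ := Gadget.terminal i
  W _ _ := 1
  U _ _ := 1
  N _ _ := 0
  wt_nonneg _ := zero_le_one
  wt_sum := by simp
  W_eq_zero_or _ _ := Or.inr le_rfl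
  U_nonneg _ _ := zero_le_one
  N_nonneg _ _ := le_rfl
  hasFlow x _ := Gadget.hasFlow_terminal i x
  hasCut _ _ h := absurd h one_ne_zero

theorem mean_terminal (i : Fin n) (F : (terminal i).Ω → ℝ) :
    (terminal i).mean F = F () := by
  change ∑ ω : Unit, 1 * F ω = _
  rw [Fintype.sum_unique, one_mul]

/-- Two independent gadgets with common root. -/
def fork (S : Ensemble n) : Ensemble n where
  Ω := S.Ω × S.Ω
  wt ω := S.wt ω.1 * S.wt ω.2
  gadget ω := (S.gadget ω.1).fork (S.gadget ω.2)
  W x ω := S.W x ω.1 + S.W x ω.2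
  U x ω := S.U x ω.1 + S.U x ω.2
  N x ω := S.N x ω.1 + S.N x ω.2
  wt_nonneg ω := mul_nonneg (S.wt_nonneg _) (S.wt_nonneg _)
  wt_sum := by
    rw [Fintype.sum_prod_type]
    simp only [← Finset.mul_sum, S.wt_sum, mul_one]
  W_eq_zero_or x ω := by
    have h2 := S.W_nonneg x ω.2
    rcases S.W_eq_zero_or x ω.1 with h | h
    · rw [h, zero_add]
      exact S.W_eq_zero_or x ω.2
    · exact Or.inr (by linarith)
  U_nonneg x ω := add_nonneg (S.U_nonneg _ _) (S.U_nonneg _ _)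
  N_nonneg x ω := add_nonneg (S.N_nonneg _ _) (S.N_nonneg _ _)
  hasFlow x ω := (S.hasFlow x ω.1).fork (S.hasFlow x ω.2)
  hasCut x ω h := by
    have h1 := S.W_nonneg x ω.1
    have h2 := S.W_nonneg x ω.2
    exact (S.hasCut x ω.1 (by linarith)).fork (S.hasCut x ω.2 (by linarith))

theorem mean_fork_mul (S : Ensemble n) (F F' : S.Ω → ℝ) :
    S.fork.mean (fun ω => F ω.1 * F' ω.2) = S.mean F * S.mean F' := by
  change ∑ ω : S.Ω × S.Ω, (S.wt ω.1 * S.wt ω.2) * (F ω.1 * F' ω.2) = _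
  rw [Fintype.sum_prod_type, mean, mean, Finset.sum_mul_sum]
  exact Finset.sum_congr rfl fun a _ => Finset.sum_congr rfl fun b _ => by ring

theorem mean_fork_add (S : Ensemble n) (F : S.Ω → ℝ) :
    S.fork.mean (fun ω => F ω.1 + F ω.2) = 2 * S.mean F := by
  rw [mean_add]
  have h1 := S.mean_fork_mul F (fun _ => 1)
  have h2 := S.mean_fork_mul (fun _ => 1) F
  simp only [mean_const, mul_one, one_mul] at h1 h2
  rw [h1, h2, two_mul]

theorem mean_fork_W (S : Ensemble n) (x : Fin n → Bool) :
    S.fork.mean (S.fork.W x) = 2 * S.mean (S.W x) := S.mean_fork_add _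

theorem mean_fork_U (S : Ensemble n) (x : Fin n → Bool) :
    S.fork.mean (S.fork.U x) = 2 * S.mean (S.U x) := S.mean_fork_add _

theorem mean_fork_N (S : Ensemble n) (x : Fin n → Bool) :
    S.fork.mean (S.fork.N x) = 2 * S.mean (S.N x) := S.mean_fork_add _

/-- Independence of the two branches turns the cross term into the square of the mean. -/
theorem mean_fork_W_sq (S : Ensemble n) (x : Fin n → Bool) :
    S.fork.mean (fun ω => S.fork.W x ω ^ 2) =
      2 * S.mean (fun ω => S.W x ω ^ 2) + 2 * S.mean (S.W x) ^ 2 := by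
  have h : (fun ω : S.fork.Ω => S.fork.W x ω ^ 2) =
      fun ω => (S.W x ω.1 ^ 2 + S.W x ω.2 ^ 2) + 2 * (S.W x ω.1 * S.W x ω.2) := by
    funext ω
    change (S.W x ω.1 + S.W x ω.2) ^ 2 = _
    ring
  rw [h, mean_add, mean_fork_add S fun ω => S.W x ω ^ 2, mean_const_mul, mean_fork_mul]
  ring

/-- The probability that `A` outputs `1` on input `x`. -/
noncomputable def _root_.RandomizedAlgorithm.accept (A : RandomizedAlgorithm n)
    (x : Fin n → Bool) : ℝ :=
  ∑ i with (A.tree i).eval x = true, A.prob i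

/-- A random gadget reached through a random decision tree of the algorithm `A`. -/
def guard (S : Ensemble n) (A : RandomizedAlgorithm n) (T : ℕ) (hA : A.QueriesAtMost T) :
    Ensemble n where
  Ω := Fin A.k × S.Ω
  wt ω := A.prob ω.1 * S.wt ω.2
  gadget ω := (S.gadget ω.2).ofTree (A.tree ω.1)
  W x ω := if (A.tree ω.1).eval x = true then S.W x ω.2 else 0
  U x ω := if (A.tree ω.1).eval x = true then S.U x ω.2 + T * S.W x ω.2 ^ 2 else 0
  N x ω := (if (A.tree ω.1).eval x = true then S.N x ω.2 else 0) + T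
  wt_nonneg ω := mul_nonneg (A.prob_nonneg _) (S.wt_nonneg _)
  wt_sum := by
    rw [Fintype.sum_prod_type]
    simp only [← Finset.mul_sum, S.wt_sum, mul_one, A.prob_sum]
  W_eq_zero_or x ω := by
    split_ifs
    · exact S.W_eq_zero_or x ω.2
    · exact Or.inl rfl
  U_nonneg x ω := by
    have := S.U_nonneg x ω.2
    split_ifs <;> positivity
  N_nonneg x ω := by
    have := S.N_nonneg x ω.2
    split_ifs <;> positivity
  hasFlow x ω := by
    have hd : ((A.tree ω.1).depth : ℝ) ≤ T := by exact_mod_cast hA ω.1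
    split_ifs with h
    · refine ((S.hasFlow x ω.2).ofTree _ h).mono ?_
      gcongr
    · exact Gadget.hasFlow_zero _ _
  hasCut x ω h := by
    have hd : ((A.tree ω.1).depth : ℝ) ≤ T := by exact_mod_cast hA ω.1
    refine (Gadget.hasCut_ofTree _ fun he => S.hasCut x ω.2 ?_).mono ?_
    · simpa [he] using h
    · gcongr

variable (S : Ensemble n) (A : RandomizedAlgorithm n) (T : ℕ) (hA : A.QueriesAtMost T)

theorem mean_guard_ite (x : Fin n → Bool) (F : S.Ω → ℝ) :
    (S.guard A T hA).mean (fun ω => if (A.tree ω.1).eval x = true then F ω.2 else 0) =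
      A.accept x * S.mean F := by
  change ∑ ω : Fin A.k × S.Ω, (A.prob ω.1 * S.wt ω.2) *
    (if (A.tree ω.1).eval x = true then F ω.2 else 0) = _
  rw [Fintype.sum_prod_type, RandomizedAlgorithm.accept, mean, Finset.sum_filter,
    Finset.sum_mul_sum]
  refine Finset.sum_congr rfl fun a _ => Finset.sum_congr rfl fun b _ => ?_
  split_ifs <;> ring

theorem mean_guard_W (x : Fin n → Bool) :
    (S.guard A T hA).mean ((S.guard A T hA).W x) = A.accept x * S.mean (S.W x) :=
  S.mean_guard_ite A T hA x _

theorem mean_guard_W_sq (x : Fin n → Bool) :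
    (S.guard A T hA).mean (fun ω => (S.guard A T hA).W x ω ^ 2) =
      A.accept x * S.mean (fun ω => S.W x ω ^ 2) := by
  rw [← S.mean_guard_ite A T hA x]
  congr 1
  funext ω
  change (if (A.tree ω.1).eval x = true then S.W x ω.2 else 0) ^ 2 = _
  split_ifs <;> simp

theorem mean_guard_U (x : Fin n → Bool) :
    (S.guard A T hA).mean ((S.guard A T hA).U x) =
      A.accept x * (S.mean (S.U x) + T * S.mean (fun ω => S.W x ω ^ 2)) := by
  rw [← mean_const_mul, ← mean_add]
  exact S.mean_guard_ite A T hA x fun ω => S.U x ω + T * S.W x ω ^ 2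

theorem mean_guard_N (x : Fin n → Bool) :
    (S.guard A T hA).mean ((S.guard A T hA).N x) = A.accept x * S.mean (S.N x) + T := by
  rw [← S.mean_guard_ite A T hA x]
  refine ((S.guard A T hA).mean_add
    (fun ω => if (A.tree ω.1).eval x = true then S.N x ω.2 else 0) (fun _ => (T : ℝ))).trans ?_
  rw [mean_const]

/-! ### Moments of the branching process -/

/-- The ensemble of binary branching programs with `L` generations whose transitions are
independent runs of `A`. -/
def branching (i : Fin n) : ℕ → Ensemble n
  | 0 => terminal i
  | L + 1 => ((branching i L).guard A T hA).fork

theorem _root_.RandomizedAlgorithm.accept_nonneg (x : Fin n → Bool) : 0 ≤ A.accept x :=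
  Finset.sum_nonneg fun i _ => A.prob_nonneg i

theorem branching_mean_W (i : Fin n) (L : ℕ) (x : Fin n → Bool) :
    (branching A T hA i L).mean ((branching A T hA i L).W x) = (2 * A.accept x) ^ L := by
  induction L with
  | zero => exact mean_terminal i _
  | succ L ih =>
    rw [branching, mean_fork_W, mean_guard_W, ih]
    ring

/-- With `M = (2p)^(2L)`, the induction needs `4pM + 2p²M ≤ 8p²M`, which is exactly `p ≥ 2/3`. -/
theorem branching_mean_W_sq_le (i : Fin n) (L : ℕ) (x : Fin n → Bool) (hx : 2 / 3 ≤ A.accept x) :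
    (branching A T hA i L).mean (fun ω => (branching A T hA i L).W x ω ^ 2) ≤
      2 * (2 * A.accept x) ^ (2 * L) := by
  induction L with
  | zero =>
    refine (mean_terminal i _).trans_le ?_
    change (1 : ℝ) ^ 2 ≤ _
    norm_num
  | succ L ih =>
    rw [branching, mean_fork_W_sq, mean_guard_W_sq, mean_guard_W, branching_mean_W]
    set p := A.accept x
    set M := (2 * p) ^ (2 * L) with hM
    have h1 : (p * (2 * p) ^ L) ^ 2 = p ^ 2 * M := by rw [hM, mul_pow, pow_mul']
    have h2 : (2 * p) ^ (2 * (L + 1)) = 4 * p ^ 2 * M := by rw [hM]; ring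
    have hp : 0 ≤ p := A.accept_nonneg x
    have hM0 : 0 ≤ M := by positivity
    rw [h1, h2]
    have h3 := mul_le_mul_of_nonneg_left ih hp
    have h4 : p * M * (2 / 3) ≤ p * M * p := mul_le_mul_of_nonneg_left hx (by positivity)
    nlinarith

/-- With `M = (2p)^(2L)`, one generation yields at most `2p(6TM + 2TM) = 16pTM`, and this is at most
`24p²TM` exactly when `p ≥ 2/3` (for `p, M > 0`). -/
theorem branching_mean_U_le (i : Fin n) (L : ℕ) (x : Fin n → Bool) (hx : 2 / 3 ≤ A.accept x)
    (hT : 1 ≤ T) :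
    (branching A T hA i L).mean ((branching A T hA i L).U x) ≤
      6 * T * (2 * A.accept x) ^ (2 * L) := by
  have hT' : (1 : ℝ) ≤ T := by exact_mod_cast hT
  induction L with
  | zero =>
    refine (mean_terminal i _).trans_le ?_
    change (1 : ℝ) ≤ _
    simp only [mul_zero, pow_zero, mul_one]
    linarith
  | succ L ih =>
    rw [branching, mean_fork_U, mean_guard_U]
    have hW := branching_mean_W_sq_le A T hA i L x hx
    set p := A.accept x
    set M := (2 * p) ^ (2 * L) with hM
    have h2 : (2 * p) ^ (2 * (L + 1)) = 4 * p ^ 2 * M := by rw [hM]; ring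
    have hp : 0 ≤ p := A.accept_nonneg x
    have hM0 : 0 ≤ M := by positivity
    rw [h2]
    have h3 := mul_le_mul_of_nonneg_left (add_le_add ih
      (mul_le_mul_of_nonneg_left hW (by positivity : (0 : ℝ) ≤ T))) hp
    have h4 : T * (p * M) * (2 / 3) ≤ T * (p * M) * p :=
      mul_le_mul_of_nonneg_left hx (by positivity)
    nlinarith

/-- The value `6T` is the fixed point of the recursion `N ↦ 2(N/3 + T)`. -/
theorem branching_mean_N_le (i : Fin n) (L : ℕ) (x : Fin n → Bool) (hx : A.accept x ≤ 1 / 3) :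
    (branching A T hA i L).mean ((branching A T hA i L).N x) ≤ 6 * T := by
  induction L with
  | zero =>
    refine (mean_terminal i _).trans_le ?_
    change (0 : ℝ) ≤ _
    positivity
  | succ L ih =>
    rw [branching, mean_fork_N, mean_guard_N]
    have h1 := mul_le_mul hx ih (mean_nonneg _ fun ω => N_nonneg _ x ω) (by norm_num)
    linarith

end Ensemble

/-! ### Decision trees and acceptance probabilities -/

theorem DecisionTree.depth_eq_zero_eval {n : ℕ} {T : DecisionTree n} (hT : T.depth = 0)
    (x y : Fin n → Bool) : T.eval x = T.eval y := by
  cases T with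
  | leaf c => rfl
  | query i t₀ t₁ => simp [DecisionTree.depth] at hT

theorem DecisionTree.exists_eval_eq_of_dependsOn {n : ℕ} (s : Finset (Fin n)) :
    ∀ g : (Fin n → Bool) → Bool, (∀ x y, (∀ i ∈ s, x i = y i) → g x = g y) →
      ∃ T : DecisionTree n, ∀ x, T.eval x = g x := by
  induction s using Finset.induction_on with
  | empty => exact fun g hg => ⟨.leaf (g fun _ => false), fun x => hg _ _ (by simp)⟩
  | insert a s _ ih =>
    intro g hg
    have h (c : Bool) := ih (fun x => g (Function.update x a c)) fun x y hxy => hg _ _ fun i hi => by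
      by_cases hia : i = a
      · subst hia; simp
      · simpa [hia] using hxy i (Finset.mem_of_mem_insert_of_ne hi hia)
    obtain ⟨T₀, h₀⟩ := h false
    obtain ⟨T₁, h₁⟩ := h true
    refine ⟨.query a T₀ T₁, fun x => ?_⟩
    cases hx : x a with
    | false =>
      have hu : Function.update x a false = x := by rw [← hx, Function.update_eq_self]
      simp [DecisionTree.eval, hx, h₀, hu]
    | true =>
      have hu : Function.update x a true = x := by rw [← hx, Function.update_eq_self]
      simp [DecisionTree.eval, hx, h₁, hu]

theorem DecisionTree.exists_eval_eq {n : ℕ} (g : (Fin n → Bool) → Bool) :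
    ∃ T : DecisionTree n, ∀ x, T.eval x = g x :=
  exists_eval_eq_of_dependsOn Finset.univ g fun x y h => by
    rw [funext fun i => h i (Finset.mem_univ i)]

theorem exists_algorithm_queriesAtMost_randomizedQueryComplexity {n : ℕ}
    {D : Set (Fin n → Bool)} (f : D → Bool) :
    ∃ A : RandomizedAlgorithm n, A.Computes f ∧ A.QueriesAtMost (randomizedQueryComplexity f) := by
  classical
  obtain ⟨T, hT⟩ := DecisionTree.exists_eval_eq fun x => if h : x ∈ D then f ⟨x, h⟩ else false
  -- The infimum is attained only because the set is nonempty: a deterministic tree computing `f`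
  -- exactly is a member.
  refine Nat.sInf_mem (s := {T | ∃ A : RandomizedAlgorithm n, A.Computes f ∧ A.QueriesAtMost T})
    ⟨T.depth, ⟨1, fun _ => T, fun _ => 1, fun _ => zero_le_one, by simp⟩, fun x => ?_,
      fun _ => le_rfl⟩
  have : T.eval x = f x := by simp [hT]
  simp only [this]
  norm_num

namespace RandomizedAlgorithm

variable {n : ℕ} {A : RandomizedAlgorithm n} {D : Set (Fin n → Bool)} {f : D → Bool}

theorem Computes.le_accept (h : A.Computes f) {x : D} (hx : f x = true) : 2 / 3 ≤ A.accept x := by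
  have := h x
  rwa [hx] at this

theorem Computes.accept_le (h : A.Computes f) {x : D} (hx : f x = false) :
    A.accept x ≤ 1 / 3 := by
  have h1 := h x
  rw [hx] at h1
  have h2 := Finset.sum_filter_add_sum_filter_not Finset.univ
    (fun i => (A.tree i).eval x = true) A.prob
  simp only [Bool.not_eq_true, A.prob_sum] at h2
  unfold accept
  linarith

/-- Without queries the acceptance probability does not depend on the input, so it cannot be both at
least `2/3` and at most `1/3`. -/
theorem Computes.eq_const_of_queriesAtMost_zero (h : A.Computes f) (h0 : A.QueriesAtMost 0) :
    ∃ c, ∀ x, f x = c := by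
  by_contra! hc
  obtain ⟨x, hx⟩ := hc false
  obtain ⟨y, hy⟩ := hc true
  have hx' := h.le_accept (x := x) (by simpa using hx)
  have hy' := h.accept_le (x := y) (by simpa using hy)
  have : A.accept x = A.accept y := by
    unfold accept
    congr 1
    ext i
    simp [DecisionTree.depth_eq_zero_eval (Nat.le_zero.1 (h0 i)) x y]
  linarith

end RandomizedAlgorithm

/-! ### Restriction to the good outcomes -/

namespace Ensemble

variable {n : ℕ} (S : Ensemble n)

/-- Outcomes of weight `0` must be left out since conductances are positive; they do not affect the
mean. -/
theorem sum_subtype_wt_mul (good : S.Ω → Prop) [DecidablePred good] (F : S.Ω → ℝ)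
    [Fintype {ω // 0 < S.wt ω ∧ good ω}] :
    ∑ ω : {ω // 0 < S.wt ω ∧ good ω}, S.wt ω * F ω =
      S.mean fun ω => if good ω then F ω else 0 := by
  classical
  rw [← Finset.sum_subtype (Finset.univ.filter fun ω => 0 < S.wt ω ∧ good ω) (by simp)
    fun ω => S.wt ω * F ω, Finset.sum_filter, mean]
  refine Finset.sum_congr rfl fun ω _ => ?_
  rcases (S.wt_nonneg ω).eq_or_lt with h | h
  · simp [← h]
  · simp [h]

/-- Second moment bound for the mean restricted to a likely event. -/
theorem half_mean_le_mean_ite (good : S.Ω → Prop) [DecidablePred good] (F : S.Ω → ℝ) {M : ℝ}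
    (hM : 0 < M) (hF : S.mean F = M) (hF2 : S.mean (fun ω => F ω ^ 2) ≤ 2 * M ^ 2)
    (hgood : S.mean (fun ω => if good ω then 0 else 1) ≤ 1 / 8) :
    M / 2 ≤ S.mean fun ω => if good ω then F ω else 0 := by
  have h := S.mean_mono (F := F) (F' := fun ω => (if good ω then F ω else 0) +
    ((8 * M)⁻¹ * F ω ^ 2 + 2 * M * (if good ω then 0 else 1))) fun ω => by
      have h0 : 0 ≤ (8 * M)⁻¹ * F ω ^ 2 := by positivity
      split_ifs
      · linarith
      -- On the bad event, AM-GM gives `F ≤ F² / (8M) + 2M`. In the mean the two terms contribute at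
      -- most `M / 4` each.
      · have h1 : 0 ≤ (8 * M)⁻¹ * (F ω - 4 * M) ^ 2 := by positivity
        have h2 : (8 * M)⁻¹ * (F ω - 4 * M) ^ 2 = (8 * M)⁻¹ * F ω ^ 2 + 2 * M - F ω := by
          field_simp
          ring
        linarith
  rw [mean_add, mean_add, mean_const_mul, mean_const_mul, hF] at h
  have h3 := mul_le_mul_of_nonneg_left hF2 (by positivity : 0 ≤ (8 * M)⁻¹)
  have h4 : (8 * M)⁻¹ * (2 * M ^ 2) = M / 4 := by field_simp; ring
  have h5 := mul_le_mul_of_nonneg_left hgood (by positivity : 0 ≤ 2 * M)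
  linarith

/-- Markov's inequality and the union bound. -/
theorem mean_ite_forall_le {X : Type} (P : Finset X) (x : X → Fin n → Bool) {δ : ℝ}
    (h : ∀ a ∈ P, S.mean (S.W (x a)) ≤ δ)
    [DecidablePred fun ω => ∀ a ∈ P, S.W (x a) ω = 0] :
    S.mean (fun ω => if ∀ a ∈ P, S.W (x a) ω = 0 then 0 else 1) ≤ P.card * δ := by
  calc S.mean (fun ω => if ∀ a ∈ P, S.W (x a) ω = 0 then 0 else 1)
      ≤ S.mean (fun ω => ∑ a ∈ P, S.W (x a) ω) := by
        refine S.mean_mono fun ω => ?_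
        split_ifs with hω
        · exact Finset.sum_nonneg fun a _ => S.W_nonneg _ _
        · push Not at hω
          obtain ⟨a, ha, hne⟩ := hω
          -- A nonzero strength is at least `1`, so the sum of the strengths dominates the indicator
          -- of the bad event.
          exact ((S.W_eq_zero_or _ _).resolve_left hne).trans
            (Finset.single_le_sum (f := fun a => S.W (x a) ω)
              (fun a _ => S.W_nonneg _ _) ha)
    _ = ∑ a ∈ P, S.mean (S.W (x a)) := by
        simp only [mean, Finset.mul_sum]
        exact Finset.sum_comm
    _ ≤ P.card * δ := by
        rw [← nsmul_eq_mul]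
        exact Finset.sum_le_card_nsmul _ _ _ h

end Ensemble

/-! ### The bound for a given algorithm and the main theorem -/

open Ensemble in
theorem stComplexity_le_of_computes {n : ℕ} (hn : 1 ≤ n) {D : Set (Fin n → Bool)} {f : D → Bool}
    {A : RandomizedAlgorithm n} (hf : A.Computes f) {T : ℕ} (hT : 1 ≤ T)
    (hA : A.QueriesAtMost T) : stComplexity f ≤ ENNReal.ofReal (24 * T) := by
  classical
  have hT' : (1 : ℝ) ≤ T := by exact_mod_cast hT
  let P : Finset D := Finset.univ.filter fun x => f x = false
  -- The number of generations depends on the number of negative inputs, which is harmless as no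
  -- later bound involves `L`.
  obtain ⟨L, hL⟩ : ∃ L : ℕ, (P.card : ℝ) * (2 / 3) ^ L ≤ 1 / 8 := by
    obtain ⟨L, hL⟩ := exists_pow_lt_of_lt_one
      (by positivity : (0 : ℝ) < 1 / (8 * (P.card + 1))) (by norm_num : (2 / 3 : ℝ) < 1)
    refine ⟨L, ?_⟩
    have hc : (0 : ℝ) ≤ P.card := Nat.cast_nonneg _
    calc (P.card : ℝ) * (2 / 3) ^ L ≤ (P.card + 1) * (1 / (8 * (P.card + 1))) := by
          gcongr
          linarith
      _ = 1 / 8 := by field_simp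
  let S := branching A T hA ⟨0, hn⟩ L
  let good : S.Ω → Prop := fun ω => ∀ x ∈ P, S.W x ω = 0
  have hbad : S.mean (fun ω => if good ω then 0 else 1) ≤ 1 / 8 := by
    refine (S.mean_ite_forall_le P (fun x => (x : Fin n → Bool)) (δ := (2 / 3) ^ L)
      fun x hx => ?_).trans hL
    have hx' : f x = false := by simpa [P] using hx
    rw [branching_mean_W]
    have := hf.accept_le hx'
    exact pow_le_pow_left₀ (mul_nonneg zero_le_two (A.accept_nonneg _)) (by linarith) L
  -- On these outcomes every negative input has strength `0`, hence a cut.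
  let ι := {ω // 0 < S.wt ω ∧ good ω}
  refine (Gadget.parallel (fun ω : ι => S.gadget ω) (fun ω => S.wt ω) fun ω => ω.2.1).stComplexity_le
    f (by linarith) (fun x hx => ?_) fun x hx => ?_
  · have hp := hf.le_accept hx
    set M := (2 * A.accept x) ^ L with hMdef
    have hM : 0 < M := pow_pos (by linarith) L
    have hM2 : (2 * A.accept x) ^ (2 * L) = M ^ 2 := pow_mul' _ _ _
    have hW2 := branching_mean_W_sq_le A T hA ⟨0, hn⟩ L x hp
    have hU := branching_mean_U_le A T hA ⟨0, hn⟩ L x hp hT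
    rw [hM2] at hW2 hU
    have hlow := S.half_mean_le_mean_ite good (S.W x) hM
      (branching_mean_W A T hA ⟨0, hn⟩ L x) hW2 hbad
    rw [← S.sum_subtype_wt_mul good (S.W x)] at hlow
    obtain ⟨g, h0, hg, hs⟩ := Gadget.exists_flow_parallel (hc := fun ω : ι => ω.2.1)
      (fun ω => S.hasFlow x ω) (lt_of_lt_of_le (half_pos hM) hlow)
    refine ⟨g, h0, hg, hs.trans ?_⟩
    have hup : ∑ ω : ι, S.wt ω * S.U x ω ≤ 6 * T * M ^ 2 := by
      rw [S.sum_subtype_wt_mul good (S.U x)]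
      refine (S.mean_mono fun ω => ?_).trans hU
      have := S.U_nonneg x ω
      split_ifs
      · exact le_rfl
      · exact this
    -- The factor `24 = 6 * 4` comes from the energy bound `6T M ^ 2` and the remaining strength of
    -- at least `M / 2`.
    rw [div_le_iff₀ (pow_pos (lt_of_lt_of_le (half_pos hM) hlow) 2)]
    calc _ ≤ 6 * T * M ^ 2 := hup
      _ = 24 * T * (M / 2) ^ 2 := by ring
      _ ≤ _ := by gcongr
  · obtain ⟨φ, h0, ha, hs⟩ := Gadget.exists_potential_parallel (hc := fun ω : ι => ω.2.1)
      (fun ω => S.hasCut x ω (ω.2.2 x (by simpa [P] using hx)))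
    refine ⟨φ, h0, ha, hs.trans ?_⟩
    have hN := branching_mean_N_le A T hA ⟨0, hn⟩ L x (hf.accept_le hx)
    rw [S.sum_subtype_wt_mul good (S.N x)]
    refine (S.mean_mono fun ω => ?_).trans (hN.trans (by linarith))
    have := S.N_nonneg x ω
    split_ifs
    · exact le_rfl
    · exact this

theorem mainTheorem2 :
    ∃ C : ℝ≥0, ∀ (n : ℕ), 1 ≤ n → ∀ (D : Set (Fin n → Bool)) (f : D → Bool),
      stComplexity f ≤ (C : ℝ≥0∞) * (randomizedQueryComplexity f : ℝ≥0∞) := by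
  refine ⟨24, fun n hn D f => ?_⟩
  obtain ⟨A, hA, hq⟩ := exists_algorithm_queriesAtMost_randomizedQueryComplexity f
  -- The branching bounds require `1 ≤ T`; with no queries `f` is constant and has complexity `0`.
  rcases Nat.eq_zero_or_pos (randomizedQueryComplexity f) with h | h
  · rw [h] at hq
    obtain ⟨c, hc⟩ := hA.eq_const_of_queriesAtMost_zero hq
    rw [STGraph.stComplexity_eq_zero_of_const hn f c hc]
    exact zero_le
  · refine (stComplexity_le_of_computes hn hA h hq).trans (le_of_eq ?_)
    rw [ENNReal.ofReal_mul (by norm_num), ENNReal.ofReal_natCast]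
    norm_num
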